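/- Let $S$ and $A$ be finite sets with $A \neq \emptyset$, let $\gamma \in [0,1)$, and let $\rho$ be a probability distribution on $S$. For every policy $\pi$ (a family of probability distributions $\pi(\cdot\mid s)$ on $A$, $s\in S$) let $r_\pi : S\times A \to \mathbb{R}$ be a reward function and $P_\pi$ a transition function, where $P_\pi(s,a,\cdot)$ is a probability distribution on $S$ for all $(s,a)$. For a transition function $P$ put $$ \mathcal{C}(P) = \Big\{ d \in \mathbb{R}_{\ge 0}^{S\times A} : \ \sum_a d(s,a) = \rho(s) + \gamma \sum_{s',a} d(s',a) P(s',a,s) \ \text{ for all } s\in S\Big\}. $$ Call $d \in \mathbb{R}^{S\times A}$ an occupancy measure if $d\in\mathcal{C}(P_\pi)$ for some policy $\pi$. For $d \ge 0$ let $\pi^d$ be the policy with $\pi^d(a\mid s) = d(s,a)/\sum_b d(s,b)$ if $\sum_b d(s,b)>0$ and $\pi^d(a\mid s) = 1/|A|$ otherwise, and write $r_d = r_{\pi^d}$ and $P_d = P_{\pi^d}$. **Proposition.** Suppose that for some constants $\varepsilon_r,\varepsilon_p$ the environment is $(\varepsilon_r,\varepsilon_p)$-sensitive, that is, $$ \|r_d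 - r_{d'}\|_2 \le \varepsilon_r \|d-d'\|_2 \quad\text{and}\quad \|P_d - P_{d'}\|_2 \le \varepsilon_p \|d-d'\|_2 $$ for all occupancy measures $d, d'$, where $\|\cdot\|_2$ is the Euclidean norm of the vector of all entries. Then there is a performatively stable occupancy measure, that is, a $d$ with $$ d \in \operatorname*{arg\,max}_{x \in \mathcal{C}(P_d)} \ \sum_{s,a} x(s,a)\, r_d(s,a). $$ -/

import Mathlib

noncomputable section

namespace PerformativeRL

/-- Stationary randomized policies: `π s` is a probability vector on the actions. -/
abbrev Policy (S A : Type*) [Fintype A] : Type _ := S → stdSimplex ℝ A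

/-- Transition functions: `P s a` is a probability vector on the next states. -/
abbrev TransitionFunction (S A : Type*) [Fintype S] : Type _ := S → A → stdSimplex ℝ S

/-- The Euclidean norm of a finite family of real numbers. -/
def l2Norm {ι : Type*} [Fintype ι] (x : ι → ℝ) : ℝ := Real.sqrt (∑ i, x i ^ 2)

/-- The uniform distribution on a finite nonempty set. -/
def uniformDist (A : Type*) [Fintype A] [Nonempty A] : stdSimplex ℝ A :=
  ⟨fun _ => 1 / (Fintype.card A : ℝ), fun _ => by positivity, by
    have h : (Fintype.card A : ℝ) ≠ 0 := by exact_mod_cast Fintype.card_ne_zero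
    simp [h]⟩

open Classical in
/-- The policy `π^d` of a vector `d ≥ 0`: `π^d(a | s) = d(s,a) / ∑ b, d(s,b)` if this sum is
positive, and the uniform distribution otherwise. (The sign condition holds for all `d ≥ 0`;
it only makes the function total.) -/
def inducedPolicy {S A : Type*} [Fintype A] [Nonempty A] (d : S × A → ℝ) : Policy S A :=
  fun s =>
    if h : (∀ a, 0 ≤ d (s, a)) ∧ 0 < ∑ b, d (s, b) then
      ⟨fun a => d (s, a) / ∑ b, d (s, b), fun a => div_nonneg (h.1 a) h.2.le, by
        rw [← Finset.sum_div]; exact div_self h.2.ne'⟩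
    else uniformDist A

end PerformativeRL

/-- A finite discounted Markov decision process whose reward function and transition function
depend on the deployed policy. -/
structure PerformativeMDP (S A : Type*) [Fintype S] [Fintype A] where
  /-- discount factor -/
  γ : ℝ
  γ_nonneg : 0 ≤ γ
  γ_lt_one : γ < 1
  /-- starting state distribution -/
  ρ : stdSimplex ℝ S
  /-- `reward π` is the reward function `r_π` -/
  reward : PerformativeRL.Policy S A → S × A → ℝ
  /-- `transition π` is the transition function `P_π` -/
  transition : PerformativeRL.Policy S A → PerformativeRL.TransitionFunction S A

namespace PerformativeMDP

open PerformativeRL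

variable {S A : Type*} [Fintype S] [Fintype A] (M : PerformativeMDP S A)

/-- The set of occupancy measures compatible with a transition function `P`: the vectors
`d ≥ 0` that satisfy the flow equations of `P` with starting distribution `ρ`. -/
def occupancyPolytope (P : TransitionFunction S A) : Set (S × A → ℝ) :=
  {d | (∀ x, 0 ≤ d x) ∧
    ∀ s, ∑ a, d (s, a) =
      (M.ρ : S → ℝ) s + M.γ * ∑ s', ∑ a, d (s', a) * (P s' a : S → ℝ) s}

/-- An occupancy measure is a vector compatible with the transition function `P_π` of one of
the environments of the model. -/
def IsOccupancyMeasure (d : S × A → ℝ) : Prop :=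
  ∃ π : Policy S A, d ∈ M.occupancyPolytope (M.transition π)

variable [Nonempty A]

/-- `r_d`, the reward function in response to the policy `π^d`. -/
def rewardOf (d : S × A → ℝ) : S × A → ℝ := M.reward (inducedPolicy d)

/-- `P_d`, the transition function in response to the policy `π^d`. -/
def transitionOf (d : S × A → ℝ) : TransitionFunction S A := M.transition (inducedPolicy d)

/-- `(εr, εp)`-sensitivity of the reward and transition mappings. -/
def IsSensitive (εr εp : ℝ) : Prop :=
  ∀ d d' : S × A → ℝ, M.IsOccupancyMeasure d → M.IsOccupancyMeasure d' →
    l2Norm (fun x : S × A => M.rewardOf d x - M.rewardOf d' x) ≤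
        εr * l2Norm (fun x : S × A => d x - d' x) ∧
    l2Norm (fun x : S × A × S =>
        (M.transitionOf d x.1 x.2.1 : S → ℝ) x.2.2 -
          (M.transitionOf d' x.1 x.2.1 : S → ℝ) x.2.2) ≤
      εp * l2Norm (fun x : S × A => d x - d' x)

/-- The set of optimal solutions `x` of the linear program
`max ∑ x(s,a) r_d(s,a)` over the occupancy measures `x` compatible with `P_d`,
that is, of the program in the environment that responds to `d`. -/
def optimalSolutions (d : S × A → ℝ) : Set (S × A → ℝ) :=
  {x | x ∈ M.occupancyPolytope (M.transitionOf d) ∧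
    IsMaxOn (fun y : S × A → ℝ => ∑ s, ∑ a, y (s, a) * M.rewardOf d (s, a))
      (M.occupancyPolytope (M.transitionOf d)) x}

/-- `d` is performatively stable: it is a fixed point of the optimal-solution correspondence. -/
def IsPerformativelyStable (d : S × A → ℝ) : Prop := d ∈ M.optimalSolutions d

end PerformativeMDP

end

/-! The set of occupancy measures need not be convex, and the environment need not depend
continuously on the deployed policy. The fixed point is therefore sought among policies, with the
occupancy measures of one fixed environment as a continuous intermediary.

Let b(π) (`baseOccupancy`) be the occupancy measure of π in the environment that answers the uniform
policy, and E(d) the environment `rewardOf d`, `transitionOf d`. Since b(π) is continuous in π and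
is an occupancy measure, sensitivity makes E(b(π)) continuous in π. So Nash's improvement map, built
from the advantages of π in E(b(π)), is continuous on a product of simplices. At a Brouwer fixed
point π has no positive advantage in E(b(π)), and by `isMaxOn_occupancy` its occupancy measure d
there solves the linear program of E(b(π)).

It remains to see that E(d) = E(b(π)) (`IsSensitive.environment_eq`). Both are occupancy measures of
the same π, so the policies they induce differ at most where only one of them visits. Let π' range
over all policies and take the occupancy measure of π in E(b(π')): this is b(π) for π' uniform and d
for π' = π. Its induced policy takes finitely many values, determined by the set of visited states,
while by sensitivity its environment varies continuously. As the policy space is connected, the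
environment is constant.

Brouwer's theorem is derived from Scarf's lemma, a parity count, on finer and finer grids. -/

noncomputable section

/-! ### Scarf's lemma -/

namespace Scarf

variable {T I : Type*}

/-- `(σ, C)` is dominant for the rankings `u i` of `T` if no element of `T` is ranked above the
lowest element of `σ` simultaneously in all rankings from `C`. -/
def IsDominant (u : I → T → ℕ) (σ : Finset T) (C : Finset I) : Prop :=
  ∀ y, ∃ i ∈ C, ∀ x ∈ σ, u i y ≤ u i x

/-- A room is a dominant pair of two sets of the same size. -/
def IsRoom (u : I → T → ℕ) (r : Finset T × Finset I) : Prop :=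
  IsDominant u r.1 r.2 ∧ r.1.card = r.2.card

lemma IsDominant.mono {u : I → T → ℕ} {σ τ : Finset T} {C D : Finset I} (h : IsDominant u σ C)
    (hτ : τ ⊆ σ) (hD : C ⊆ D) : IsDominant u τ D := fun y => by
  obtain ⟨i, hi, h'⟩ := h y
  exact ⟨i, hD hi, fun x hx => h' x (hτ hx)⟩

variable [DecidableEq T] [DecidableEq I]

/-! ### Doors (`D` one larger than `τ`) and the rooms around them. -/

open Classical in
/-- The members of `D` that can be dropped such that each element of `τ` is still ranked lowest by
some member. -/
def removable (u : I → T → ℕ) (τ : Finset T) (D : Finset I) : Finset I :=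
  D.filter fun k => ∀ x ∈ τ, ∃ l ∈ D.erase k, ∀ x' ∈ τ, u l x ≤ u l x'

/-- The room `r` arises from the door `(τ, D)` by replacing the lowest element of `τ` in the
ranking `k` or by dropping `k`. -/
def Opens (u : I → T → ℕ) (τ : Finset T) (D : Finset I) (k : I) (r : Finset T × Finset I) : Prop :=
  (r.1 = τ ∧ r.2 = D.erase k) ∨
    (r.2 = D ∧ ∃ y, (∀ l ∈ D.erase k, ∃ x ∈ τ, u l x < u l y) ∧ r.1 = insert y τ)

variable {u : I → T → ℕ} {τ : Finset T} {D : Finset I}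

omit [DecidableEq T] in
lemma mem_of_mem_removable {k : I} (hk : k ∈ removable u τ D) : k ∈ D := by
  classical
  exact Finset.mem_of_mem_filter k hk

/-- Send each ranking in `D` to its lowest element of `τ`. Dominance at the points of `τ` makes this
map onto, so exactly one fiber has two members, and these are the removable rankings. -/
lemma card_removable (hu : ∀ i, Function.Injective (u i)) (hd : IsDominant u τ D)
    (hcard : D.card = τ.card + 1) (hτ : τ.Nonempty) : (removable u τ D).card = 2 := by
  have hmin : ∀ l, ∃ x ∈ τ, ∀ x' ∈ τ, u l x ≤ u l x' := fun l => τ.exists_min_image (u l) hτ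
  choose f hfτ hf using hmin
  have huniq : ∀ l, ∀ x ∈ τ, (∀ x' ∈ τ, u l x ≤ u l x') → f l = x := fun l x hx h =>
    hu l (le_antisymm (hf l x hx) (h _ (hfτ l)))
  have hsurj : ∀ x ∈ τ, ∃ l ∈ D, f l = x := fun x hx => by
    obtain ⟨l, hl, h⟩ := hd x
    exact ⟨l, hl, huniq l x hx h⟩
  have hmem : ∀ k, k ∈ removable u τ D ↔ k ∈ D ∧ ∀ x ∈ τ, ∃ l ∈ D.erase k, f l = x := by
    intro k
    simp only [removable, Finset.mem_filter]
    refine and_congr_right fun _ => forall₂_congr fun x hx => exists_congr fun l =>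
      and_congr_right fun _ => ⟨huniq l x hx, fun h => h ▸ hf l⟩
  obtain ⟨i, hi, j, hj, hij, hfij⟩ := Finset.exists_ne_map_eq_of_card_lt_of_maps_to
    (s := D) (t := τ) (by omega) (fun l _ => hfτ l)
  have hinj : ∀ a ∈ D.erase i, ∀ b ∈ D.erase i, f a = f b → a = b := by
    have himg : (D.erase i).image f = τ := by
      apply Finset.Subset.antisymm
      · intro x hx
        obtain ⟨l, -, rfl⟩ := Finset.mem_image.1 hx
        exact hfτ l
      · intro x hx
        obtain ⟨l, hl, rfl⟩ := hsurj x hx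
        by_cases hli : l = i
        · exact Finset.mem_image.2 ⟨j, by simp [hj, hij.symm], by rw [hli, hfij]⟩
        · exact Finset.mem_image.2 ⟨l, by simp [hl, hli], rfl⟩
    have : Set.InjOn f (D.erase i : Finset I) := by
      apply Finset.card_image_iff.1
      rw [himg, Finset.card_erase_of_mem hi]; omega
    exact fun a ha b hb h => this ha hb h
  have : removable u τ D = {i, j} := by
    ext k
    rw [hmem]
    simp only [Finset.mem_insert, Finset.mem_singleton]
    constructor
    · rintro ⟨hk, h⟩
      by_contra! hne
      obtain ⟨l, hl, hfl⟩ := h (f k) (hfτ k)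
      simp only [Finset.mem_erase] at hl hinj
      by_cases hli : l = i
      · exact hne.2 (hinj k ⟨hne.1, hk⟩ j ⟨hij.symm, hj⟩ (by rw [← hfl, hli, hfij]))
      · exact hl.1 (hinj l ⟨hli, hl.2⟩ k ⟨hne.1, hk⟩ hfl)
    · have key : ∀ a b, a ∈ D → b ∈ D → a ≠ b → f a = f b →
          ∀ x ∈ τ, ∃ l ∈ D.erase a, f l = x := by
        intro a b ha hb hab hfab x hx
        obtain ⟨l, hl, rfl⟩ := hsurj x hx
        by_cases hla : l = a
        · exact ⟨b, by simp [hb, hab.symm], by rw [hla, hfab]⟩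
        · exact ⟨l, by simp [hl, hla], rfl⟩
      rintro (rfl | rfl)
      · exact ⟨hi, key _ _ hi hj hij hfij⟩
      · exact ⟨hj, key _ _ hj hi hij.symm hfij.symm⟩
  rw [this, Finset.card_pair hij]

omit [DecidableEq T] in
lemma notMem_of_removable {k : I} (hk : k ∈ removable u τ D) {y : T}
    (hy : ∀ l ∈ D.erase k, ∃ x ∈ τ, u l x < u l y) : y ∉ τ := fun hyτ => by
  simp only [removable, Finset.mem_filter] at hk
  obtain ⟨l, hl, h⟩ := hk.2 y hyτ
  obtain ⟨x, hx, h'⟩ := hy l hl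
  exact absurd (h x hx) (not_le.2 h')

/-- Consider the points that beat the minimum of `τ` in every ranking of `D` other than `k`. If
there are none, `k` can be dropped; otherwise the one that `k` ranks highest can be added. -/
lemma exists_room_opens [Fintype T] (hd : IsDominant u τ D)
    (hcard : D.card = τ.card + 1) {k : I} (hk : k ∈ removable u τ D) :
    ∃ r, IsRoom u r ∧ Opens u τ D k r := by
  classical
  have hkD : k ∈ D := mem_of_mem_removable hk
  by_cases hM : ∃ y, ∀ l ∈ D.erase k, ∃ x ∈ τ, u l x < u l y
  · obtain ⟨y, hy, hmax⟩ := Set.exists_max_image {y | ∀ l ∈ D.erase k, ∃ x ∈ τ, u l x < u l y}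
      (u k) (Set.toFinite _) hM
    simp only [Set.mem_ofPred_eq] at hy hmax
    refine ⟨(insert y τ, D), ⟨fun z => ?_, ?_⟩, Or.inr ⟨rfl, y, hy, rfl⟩⟩
    · by_cases hz : ∀ l ∈ D.erase k, ∃ x ∈ τ, u l x < u l z
      · refine ⟨k, hkD, fun x hx => ?_⟩
        rcases Finset.mem_insert.1 hx with rfl | hx
        · exact hmax z hz
        · obtain ⟨i, hi, h⟩ := hd z
          by_cases hik : i = k
          · exact hik ▸ h x hx
          · obtain ⟨x', hx', h'⟩ := hz i (Finset.mem_erase.2 ⟨hik, hi⟩)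
            exact absurd (h x' hx') (not_le.2 h')
      · push Not at hz
        obtain ⟨l, hl, h⟩ := hz
        refine ⟨l, Finset.mem_of_mem_erase hl, fun x hx => ?_⟩
        rcases Finset.mem_insert.1 hx with rfl | hx
        · obtain ⟨x', hx', h'⟩ := hy l hl
          exact (h x' hx').trans h'.le
        · exact h x hx
    · simp only
      rw [Finset.card_insert_of_notMem (notMem_of_removable hk hy), hcard]
  · push Not at hM
    refine ⟨(τ, D.erase k), ⟨hM, ?_⟩, Or.inl ⟨rfl, rfl⟩⟩
    simp only
    rw [Finset.card_erase_of_mem hkD]; omega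

/-- Dropping `k` excludes any candidate for insertion, and dominance forces an inserted point to be
the candidate that `k` ranks highest. -/
lemma room_opens_unique (hu : ∀ i, Function.Injective (u i)) {k : I} (hkD : k ∈ D)
    {r r' : Finset T × Finset I} (hr : IsRoom u r) (hr' : IsRoom u r')
    (h : Opens u τ D k r) (h' : Opens u τ D k r') : r = r' := by
  obtain ⟨σ, C⟩ := r
  obtain ⟨σ', C'⟩ := r'
  simp only [Opens, IsRoom] at hr hr' h h'
  have key : ∀ y, (∀ l ∈ D.erase k, ∃ x ∈ τ, u l x < u l y) → ∀ ρ : Finset T, τ ⊆ ρ →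
      IsDominant u ρ D → ∀ x ∈ ρ, u k y ≤ u k x := by
    intro y hy ρ hρ hdom
    obtain ⟨i, hi, hle⟩ := hdom y
    by_cases hik : i = k
    · exact hik ▸ hle
    · obtain ⟨x, hx, hlt⟩ := hy i (Finset.mem_erase.2 ⟨hik, hi⟩)
      exact absurd (hle x (hρ hx)) (not_le.2 hlt)
  have contra : IsDominant u τ (D.erase k) →
      ∀ y, (∀ l ∈ D.erase k, ∃ x ∈ τ, u l x < u l y) → False := by
    intro hdom y hy
    obtain ⟨i, hi, hle⟩ := hdom y
    obtain ⟨x, hx, hlt⟩ := hy i hi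
    exact absurd (hle x hx) (not_le.2 hlt)
  rcases h with ⟨rfl, rfl⟩ | ⟨rfl, y, hy, rfl⟩ <;> rcases h' with ⟨rfl, rfl⟩ | ⟨rfl, y', hy', rfl⟩
  · rfl
  · exact (contra hr.1 y' hy').elim
  · exact (contra hr'.1 y hy).elim
  · have h1 := key y hy _ (Finset.subset_insert _ _) hr'.1 y' (Finset.mem_insert_self _ _)
    have h2 := key y' hy' _ (Finset.subset_insert _ _) hr.1 y (Finset.mem_insert_self _ _)
    rw [hu k (le_antisymm h1 h2)]

/-- Comparing sizes, the room has either one ranking fewer or one point more than the door. In the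
second case dominance matches the points of the room bijectively with rankings in which they are
lowest, and `k` is the partner of the extra point. -/
lemma exists_opens (hu : ∀ i, Function.Injective (u i)) (hcard : D.card = τ.card + 1)
    {r : Finset T × Finset I} (hr : IsRoom u r) (hτ : τ ⊆ r.1) (hD : r.2 ⊆ D) :
    ∃ k ∈ removable u τ D, Opens u τ D k r := by
  obtain ⟨σ, C⟩ := r
  obtain ⟨hdom, hsize⟩ := hr
  simp only at hτ hD hdom hsize
  have h1 := Finset.card_le_card hτ
  have h2 := Finset.card_le_card hD
  by_cases hc : C.card = τ.card
  · obtain rfl : τ = σ := Finset.eq_of_subset_of_card_le hτ (by omega)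
    obtain ⟨k, hk, rfl⟩ : ∃ k ∈ D, C = D.erase k := by
      obtain ⟨k, hk⟩ := Finset.card_eq_one.1 (show (D \ C).card = 1 by
        rw [Finset.card_sdiff_of_subset hD]; omega)
      have hk' : k ∈ D \ C := by simp [hk]
      refine ⟨k, (Finset.mem_sdiff.1 hk').1, ?_⟩
      rw [← Finset.sdiff_singleton_eq_erase, ← hk, Finset.sdiff_sdiff_eq_self hD]
    exact ⟨k, Finset.mem_filter.2 ⟨hk, fun x _ => hdom x⟩, Or.inl ⟨rfl, rfl⟩⟩
  · obtain rfl : C = D := Finset.eq_of_subset_of_card_le hD (by omega)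
    obtain ⟨y, hyτ, rfl⟩ : ∃ y, y ∉ τ ∧ insert y τ = σ :=
      (Finset.exists_eq_insert_iff.2 ⟨hτ, by omega⟩)
    choose g hgC hg using hdom
    have hinj : Set.InjOn g (insert y τ : Finset T) := fun a ha b hb hab =>
      hu (g a) (le_antisymm (hg a b hb) (by have := hg b a ha; rwa [← hab] at this))
    have hsurj : ∀ l ∈ C, ∃ x ∈ insert y τ, g x = l := by
      have : (insert y τ).image g = C := Finset.eq_of_subset_of_card_le
        (fun l hl => by obtain ⟨x, -, rfl⟩ := Finset.mem_image.1 hl; exact hgC x)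
        (by rw [Finset.card_image_of_injOn hinj, hsize])
      intro l hl
      rw [← this] at hl
      exact Finset.mem_image.1 hl
    have hy' : y ∈ insert y τ := Finset.mem_insert_self _ _
    refine ⟨g y, Finset.mem_filter.2 ⟨hgC y, fun x hx => ⟨g x, ?_, fun x' hx' => ?_⟩⟩,
      Or.inr ⟨rfl, y, fun l hl => ?_, rfl⟩⟩
    · refine Finset.mem_erase.2 ⟨fun h => ?_, hgC x⟩
      exact hyτ (hinj (Finset.mem_insert_of_mem hx) hy' h ▸ hx)
    · exact hg x x' (Finset.mem_insert_of_mem hx')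
    · obtain ⟨hne, hl⟩ := Finset.mem_erase.1 hl
      obtain ⟨x, hx, rfl⟩ := hsurj l hl
      have hxy : x ≠ y := fun h => hne (h ▸ rfl)
      refine ⟨x, (Finset.mem_insert.1 hx).resolve_left hxy, lt_of_le_of_ne (hg x y hy') ?_⟩
      exact fun h => hxy (hu _ h)

/-- A point inserted for two different indices would beat the minimum of `τ` in every ranking of
`D`, against dominance of the door. -/
lemma opens_unique (hd : IsDominant u τ D) {k k' : I} (hk : k ∈ removable u τ D)
    (hk' : k' ∈ removable u τ D) {r : Finset T × Finset I}
    (h : Opens u τ D k r) (h' : Opens u τ D k' r) : k = k' := by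
  obtain ⟨σ, C⟩ := r
  simp only [Opens] at h h'
  have hkD : k ∈ D := mem_of_mem_removable hk
  have hkD' : k' ∈ D := mem_of_mem_removable hk'
  rcases h with ⟨rfl, rfl⟩ | ⟨rfl, y, hy, rfl⟩ <;> rcases h' with ⟨h1, h2⟩ | ⟨h2, y', hy', h1⟩
  · by_contra hne
    have : k' ∈ D.erase k := Finset.mem_erase.2 ⟨Ne.symm hne, hkD'⟩
    rw [h2] at this
    simp at this
  · rw [← h2] at hkD; simp at hkD
  · rw [h2] at hkD'; simp at hkD'
  · have hyy : y = y' := by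
      have : y ∈ insert y' τ := h1 ▸ Finset.mem_insert_self _ _
      exact (Finset.mem_insert.1 this).resolve_right (notMem_of_removable hk hy)
    subst hyy
    by_contra hne
    obtain ⟨i, hi, hle⟩ := hd y
    by_cases hik : i = k
    · obtain ⟨x, hx, hlt⟩ := hy' i (Finset.mem_erase.2 ⟨hik ▸ hne, hi⟩)
      exact absurd (hle x hx) (not_le.2 hlt)
    · obtain ⟨x, hx, hlt⟩ := hy i (Finset.mem_erase.2 ⟨hik, hi⟩)
      exact absurd (hle x hx) (not_le.2 hlt)

lemma Opens.subset {k : I} {r : Finset T × Finset I} (h : Opens u τ D k r) :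
    τ ⊆ r.1 ∧ r.2 ⊆ D := by
  rcases h with ⟨h1, h2⟩ | ⟨h2, y, -, h1⟩
  · exact ⟨h1 ▸ subset_rfl, h2 ▸ Finset.erase_subset _ _⟩
  · exact ⟨h1 ▸ Finset.subset_insert _ _, h2 ▸ subset_rfl⟩

open Classical in
-- Rooms around a door correspond to removable rankings through `Opens`; with `card_removable`, a
-- door with nonempty `τ` has exactly two rooms.
lemma card_rooms_of_door [Fintype T] [Fintype I] (hu : ∀ i, Function.Injective (u i))
    (hd : IsDominant u τ D) (hcard : D.card = τ.card + 1) :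
    (Finset.univ.filter fun r : Finset T × Finset I =>
      IsRoom u r ∧ τ ⊆ r.1 ∧ r.2 ⊆ D).card = (removable u τ D).card := by
  symm
  have hex := fun k (hk : k ∈ removable u τ D) => exists_room_opens hd hcard hk
  refine Finset.card_bij (fun k hk => (hex k hk).choose) ?_ ?_ ?_
  · intro k hk
    obtain ⟨h1, h2⟩ := (hex k hk).choose_spec
    exact Finset.mem_filter.2 ⟨Finset.mem_univ _, h1, h2.subset⟩
  · intro k hk k' hk' h
    refine opens_unique hd hk hk' (hex k hk).choose_spec.2 ?_
    rw [h]
    exact (hex k' hk').choose_spec.2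
  · intro r hr
    replace hr := (Finset.mem_filter.1 hr).2
    obtain ⟨k, hk, hop⟩ := exists_opens hu hcard hr.1 hr.2.1 hr.2.2
    exact ⟨k, hk, room_opens_unique hu (mem_of_mem_removable hk) (hex k hk).choose_spec.1 hr.1
      (hex k hk).choose_spec.2 hop⟩

/-! ### Colored doors and the parity count. -/

/-- `τ` together with the colors `c '' τ` and `i₀` is a potential door: the colors of `τ` are
distinct and different from `i₀`. -/
def IsTyped (c : T → I) (i₀ : I) (τ : Finset T) : Prop :=
  Set.InjOn c τ ∧ i₀ ∉ τ.image c

omit [DecidableEq T] in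
lemma IsTyped.card {c : T → I} {i₀ : I} {τ : Finset T} (h : IsTyped c i₀ τ) :
    (insert i₀ (τ.image c)).card = τ.card + 1 := by
  rw [Finset.card_insert_of_notMem h.2, Finset.card_image_of_injOn h.1]

open Classical in
-- A room whose colors are its rankings has one typed door; any other room has none or two.
lemma odd_card_typed_iff (c : T → I) (i₀ : I) {σ : Finset T} {C : Finset I}
    (hcard : σ.card = C.card) :
    Odd (σ.powerset.filter fun τ => IsTyped c i₀ τ ∧ C ⊆ insert i₀ (τ.image c)).card ↔
      σ.image c = C := by
  set F := σ.powerset.filter fun τ => IsTyped c i₀ τ ∧ C ⊆ insert i₀ (τ.image c) with hFdef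
  have hF : ∀ τ, τ ∈ F ↔ (τ = σ ∨ ∃ x ∈ σ, τ = σ.erase x) ∧ IsTyped c i₀ τ ∧
      C ⊆ insert i₀ (τ.image c) := by
    intro τ
    rw [hFdef, Finset.mem_filter, Finset.mem_powerset]
    refine ⟨fun ⟨h, ht, hC⟩ => ⟨?_, ht, hC⟩, fun ⟨h, ht⟩ => ⟨?_, ht⟩⟩
    · have h1 := Finset.card_le_card hC
      rw [ht.card] at h1
      by_cases hc : σ.card ≤ τ.card
      · exact Or.inl (Finset.eq_of_subset_of_card_le h hc)
      · obtain ⟨x, hx, rfl⟩ := Finset.exists_eq_insert_iff.2 ⟨h, by omega⟩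
        exact Or.inr ⟨x, Finset.mem_insert_self _ _, by rw [Finset.erase_insert hx]⟩
    · rcases h with rfl | ⟨x, -, rfl⟩
      · exact subset_rfl
      · exact Finset.erase_subset _ _
  constructor
  · intro hodd
    by_contra hne
    suffices ∃ a b, a ≠ b ∧ F = {a, b} by
      obtain ⟨a, b, hab, h⟩ := this
      rw [h, Finset.card_pair hab] at hodd
      exact absurd hodd (by decide)
    by_cases hσ : σ ∈ F
    -- If `σ` itself gives a door, then `i₀` and the colors of `σ` exceed `C` by a single color `c
    -- x`; erasing `x` gives the other door.
    · obtain ⟨-, ⟨hinj, hi⟩, hC⟩ := (hF σ).1 hσ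
      have hiC : i₀ ∈ C := by
        by_contra hiC
        exact hne (Finset.eq_of_subset_of_card_le ((Finset.subset_insert_iff_of_notMem hiC).1 hC)
          (by rw [Finset.card_image_of_injOn hinj, hcard])).symm
      obtain ⟨x, hx, hxC⟩ : ∃ x ∈ σ, c x ∉ C := by
        by_contra! h
        have : σ.image c ⊆ C := fun j hj => by
          obtain ⟨x, hx, rfl⟩ := Finset.mem_image.1 hj; exact h x hx
        exact hne (Finset.eq_of_subset_of_card_le this
          (by rw [Finset.card_image_of_injOn hinj, hcard]))
      have heq : insert (c x) C = insert i₀ (σ.image c) := by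
        refine Finset.eq_of_subset_of_card_le (Finset.insert_subset ?_ hC) ?_
        · exact Finset.mem_insert_of_mem (Finset.mem_image_of_mem _ hx)
        · rw [Finset.card_insert_of_notMem hxC, Finset.card_insert_of_notMem hi,
            Finset.card_image_of_injOn hinj, hcard]
      refine ⟨σ, σ.erase x, fun h => by rw [h] at hx; simp at hx, ?_⟩
      ext τ
      rw [Finset.mem_insert, Finset.mem_singleton]
      constructor
      · intro hτ
        obtain ⟨rfl | ⟨z, hz, rfl⟩, -, hC'⟩ := (hF τ).1 hτ
        · exact Or.inl rfl
        · right
          have hzC : c z ∉ C := fun hzC => by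
            have := hC' hzC
            simp only [Finset.mem_insert, Finset.mem_image, Finset.mem_erase] at this
            obtain h | ⟨w, ⟨hwz, hw⟩, h⟩ := this
            · exact hi (h ▸ Finset.mem_image_of_mem _ hz)
            · exact hwz (hinj hw hz h)
          have : c z ∈ insert (c x) C := heq ▸
            Finset.mem_insert_of_mem (Finset.mem_image_of_mem _ hz)
          rw [hinj hz hx ((Finset.mem_insert.1 this).resolve_right hzC)]
      · rintro (rfl | rfl)
        · exact hσ
        · refine (hF _).2 ⟨Or.inr ⟨x, hx, rfl⟩, ⟨hinj.mono (Finset.erase_subset _ _),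
            fun h => hi (Finset.image_subset_image (Finset.erase_subset _ _) h)⟩, fun j hj => ?_⟩
          rcases Finset.mem_insert.1 (hC hj) with rfl | hj'
          · exact Finset.mem_insert_self _ _
          · obtain ⟨w, hw, rfl⟩ := Finset.mem_image.1 hj'
            refine Finset.mem_insert_of_mem (Finset.mem_image_of_mem _ (Finset.mem_erase.2 ⟨?_, hw⟩))
            rintro rfl; exact hxC hj
    -- Otherwise a door erases some `x` whose color is repeated at another point `x'`; erasing `x'`
    -- instead gives the other door.
    · obtain ⟨τ, hτ⟩ : F.Nonempty := Finset.card_pos.1 hodd.pos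
      obtain ⟨rfl | ⟨x, hx, rfl⟩, ⟨hinj, hi⟩, hC⟩ := (hF τ).1 hτ
      · exact absurd hτ hσ
      have hCeq : C = insert i₀ ((σ.erase x).image c) := by
        refine Finset.eq_of_subset_of_card_le hC ?_
        rw [IsTyped.card ⟨hinj, hi⟩, Finset.card_erase_of_mem hx, ← hcard]
        have := Finset.card_pos.2 ⟨x, hx⟩
        omega
      have himg : σ.image c = insert (c x) ((σ.erase x).image c) := by
        rw [← Finset.image_insert, Finset.insert_erase hx]
      have hxi : c x ≠ i₀ := fun h => hne (by rw [himg, hCeq, h])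
      obtain ⟨x', hx', hxx'⟩ : ∃ x' ∈ σ.erase x, c x' = c x := by
        by_contra! h
        refine hσ ((hF σ).2 ⟨Or.inl rfl, ⟨?_, ?_⟩, ?_⟩)
        · intro a ha b hb hab
          by_cases hax : a = x <;> by_cases hbx : b = x
          · rw [hax, hbx]
          · exact absurd (hax ▸ hab.symm) (h b (Finset.mem_erase.2 ⟨hbx, hb⟩))
          · exact absurd (hbx ▸ hab) (h a (Finset.mem_erase.2 ⟨hax, ha⟩))
          · exact hinj (Finset.mem_erase.2 ⟨hax, ha⟩) (Finset.mem_erase.2 ⟨hbx, hb⟩) hab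
        · rw [himg, Finset.mem_insert]
          exact fun h => h.elim (fun h => hxi h.symm) hi
        · exact hC.trans (Finset.insert_subset_insert _
            (Finset.image_subset_image (Finset.erase_subset _ _)))
      obtain ⟨hne', hxσ'⟩ := Finset.mem_erase.1 hx'
      have himg' : (σ.erase x').image c = (σ.erase x).image c := by
        ext j
        simp only [Finset.mem_image, Finset.mem_erase]
        constructor
        · rintro ⟨w, ⟨hw, hwσ⟩, rfl⟩
          by_cases h : w = x
          · exact ⟨x', ⟨hne', hxσ'⟩, by rw [hxx', h]⟩
          · exact ⟨w, ⟨h, hwσ⟩, rfl⟩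
        · rintro ⟨w, ⟨hw, hwσ⟩, rfl⟩
          by_cases h : w = x'
          · exact ⟨x, ⟨hne'.symm, hx⟩, by rw [h, hxx']⟩
          · exact ⟨w, ⟨h, hwσ⟩, rfl⟩
      refine ⟨σ.erase x, σ.erase x', fun h => by rw [h] at hx'; simp at hx', ?_⟩
      ext τ
      rw [Finset.mem_insert, Finset.mem_singleton]
      constructor
      · intro hτ'
        obtain ⟨rfl | ⟨z, hz, rfl⟩, ⟨hinj', -⟩, -⟩ := (hF τ).1 hτ'
        · exact absurd hτ' hσ
        · by_contra! h
          have h1 : x ≠ z := fun e => h.1 (by rw [e])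
          have h2 : x' ≠ z := fun e => h.2 (by rw [e])
          exact hne' (hinj' (Finset.mem_erase.2 ⟨h2, hxσ'⟩) (Finset.mem_erase.2 ⟨h1, hx⟩) hxx')
      · rintro (rfl | rfl)
        · exact hτ
        · refine (hF _).2 ⟨Or.inr ⟨x', hxσ', rfl⟩, ⟨?_, himg' ▸ hi⟩, himg' ▸ hC⟩
          apply Finset.card_image_iff.1
          rw [himg', Finset.card_image_of_injOn hinj, Finset.card_erase_of_mem hx,
            Finset.card_erase_of_mem hxσ']
  · intro hcol
    suffices ∃ a, F = {a} by
      obtain ⟨a, h⟩ := this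
      rw [h, Finset.card_singleton]; exact odd_one
    have hinj : Set.InjOn c σ := Finset.card_image_iff.1 (by rw [hcol, hcard])
    by_cases hi : i₀ ∈ C
    · obtain ⟨x, hx, hxi⟩ := Finset.mem_image.1 (hcol.symm ▸ hi)
      refine ⟨σ.erase x, ?_⟩
      ext τ
      rw [Finset.mem_singleton]
      constructor
      · intro hτ
        obtain ⟨rfl | ⟨z, hz, rfl⟩, ⟨-, hi'⟩, -⟩ := (hF τ).1 hτ
        · exact absurd (hcol ▸ hi) hi'
        · by_contra h
          refine hi' (Finset.mem_image.2 ⟨x, Finset.mem_erase.2 ⟨fun e => h (by rw [e]), hx⟩, hxi⟩)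
      · rintro rfl
        refine (hF _).2 ⟨Or.inr ⟨x, hx, rfl⟩, ⟨hinj.mono (Finset.erase_subset _ _), fun h => ?_⟩,
          fun j hj => ?_⟩
        · obtain ⟨w, hw, hwi⟩ := Finset.mem_image.1 h
          obtain ⟨hw1, hw2⟩ := Finset.mem_erase.1 hw
          exact hw1 (hinj hw2 hx (hwi.trans hxi.symm))
        · obtain ⟨w, hw, rfl⟩ := Finset.mem_image.1 (hcol.symm ▸ hj)
          by_cases h : w = x
          · rw [h, hxi]; exact Finset.mem_insert_self _ _
          · exact Finset.mem_insert_of_mem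
              (Finset.mem_image_of_mem _ (Finset.mem_erase.2 ⟨h, hw⟩))
    · refine ⟨σ, ?_⟩
      ext τ
      rw [Finset.mem_singleton]
      constructor
      · intro hτ
        obtain ⟨rfl | ⟨z, hz, rfl⟩, -, hC⟩ := (hF τ).1 hτ
        · rfl
        · have hzC : c z ∈ C := hcol ▸ Finset.mem_image_of_mem _ hz
          rcases Finset.mem_insert.1 (hC hzC) with h | h
          · exact absurd (h ▸ hzC) hi
          · obtain ⟨w, hw, hwz⟩ := Finset.mem_image.1 h
            obtain ⟨hw1, hw2⟩ := Finset.mem_erase.1 hw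
            exact absurd (hinj hw2 hz hwz) hw1
      · rintro rfl
        exact (hF _).2 ⟨Or.inl rfl, ⟨hinj, hcol ▸ hi⟩, hcol ▸ Finset.subset_insert _ _⟩

open Classical in
/-- **Scarf's lemma**: for every coloring there is a room whose colors are its rankings. -/
theorem exists_colorful [Fintype T] [Nonempty T] [Fintype I] [Nonempty I]
    (hu : ∀ i, Function.Injective (u i)) (c : T → I) :
    ∃ (σ : Finset T) (C : Finset I), IsDominant u σ C ∧ σ.image c = C := by
  let i₀ : I := Classical.arbitrary I
  let doors : Finset (Finset T) := Finset.univ.filter fun τ =>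
    IsTyped c i₀ τ ∧ IsDominant u τ (insert i₀ (τ.image c))
  let rooms : Finset (Finset T × Finset I) := Finset.univ.filter fun r => IsRoom u r
  let rel : Finset T → Finset T × Finset I → Prop := fun τ r =>
    τ ⊆ r.1 ∧ r.2 ⊆ insert i₀ (τ.image c)
  have hcount := Finset.sum_card_bipartiteAbove_eq_sum_card_bipartiteBelow (s := doors)
    (t := rooms) rel
  have hdoor : ∀ τ ∈ doors, (rooms.bipartiteAbove rel τ).card = if τ = ∅ then 1 else 2 := by
    intro τ hτ
    obtain ⟨ht, hd⟩ := (Finset.mem_filter.1 hτ).2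
    have h1 : rooms.bipartiteAbove rel τ = Finset.univ.filter fun r : Finset T × Finset I =>
        IsRoom u r ∧ τ ⊆ r.1 ∧ r.2 ⊆ insert i₀ (τ.image c) := by
      rw [Finset.bipartiteAbove, Finset.filter_filter]
    rw [h1, card_rooms_of_door hu hd ht.card]
    split_ifs with he
    · subst he
      have : removable u (∅ : Finset T) (insert i₀ ((∅ : Finset T).image c)) = {i₀} := by
        ext k
        simp [removable]
      rw [this, Finset.card_singleton]
    · exact card_removable hu hd ht.card (Finset.nonempty_iff_ne_empty.2 he)
  have hempty : ∅ ∈ doors := Finset.mem_filter.2 ⟨Finset.mem_univ _, by simp [IsTyped],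
    fun y => ⟨i₀, by simp, by simp⟩⟩
  -- The empty door is the only one with a single room, so the number of incidences is odd.
  have hodd : Odd (∑ τ ∈ doors, (rooms.bipartiteAbove rel τ).card) := by
    rw [← Finset.add_sum_erase _ _ hempty, hdoor _ hempty, if_pos rfl, add_comm]
    refine Even.add_odd (Finset.even_sum _ fun τ hτ => ?_) odd_one
    obtain ⟨h1, h2⟩ := Finset.mem_erase.1 hτ
    rw [hdoor τ h2, if_neg h1]
    exact even_two
  rw [hcount] at hodd
  obtain ⟨r, hr, hr'⟩ : ∃ r ∈ rooms, Odd (doors.bipartiteBelow rel r).card := by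
    by_contra! h
    exact Nat.not_odd_iff_even.2
      (Finset.even_sum _ fun r hr => Nat.not_odd_iff_even.1 (h r hr)) hodd
  obtain ⟨hdom, hcard⟩ := (Finset.mem_filter.1 hr).2
  refine ⟨r.1, r.2, hdom, (odd_card_typed_iff c i₀ hcard).1 ?_⟩
  convert hr' using 2
  ext τ
  simp only [doors, rel, Finset.bipartiteBelow, Finset.mem_filter, Finset.mem_powerset,
    Finset.mem_univ, true_and]
  exact ⟨fun ⟨h1, h2, h3⟩ => ⟨⟨h2, hdom.mono h1 h3⟩, h1, h3⟩,
    fun ⟨⟨h1, _⟩, h2, h3⟩ => ⟨h2, h1, h3⟩⟩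

end Scarf

end

noncomputable section

/-! ### Brouwer's fixed point theorem on products of simplices -/

namespace Brouwer

variable {I : Type*} [Fintype I]

lemma continuous_stdSimplex_apply (i : I) : Continuous fun x : stdSimplex ℝ I => x i :=
  (continuous_apply i).comp continuous_subtype_val

/-- The grid points of resolution `N` in the standard simplex, scaled by `N`. -/
abbrev Grid (I : Type*) [Fintype I] (N : ℕ) : Type _ :=
  {x : I → Fin (N + 1) // ∑ i, (x i : ℕ) = N}

lemma exists_grid {N : ℕ} (m : I → ℕ) (i₀ : I) (hm : ∑ i, m i ≤ N) :
    ∃ y : Grid I N, ∀ i, m i ≤ (y.1 i : ℕ) := by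
  classical
  let z : I → ℕ := m + Pi.single i₀ (N - ∑ i, m i)
  have hz : ∑ i, z i = N := by
    simp only [z, Pi.add_apply, Finset.sum_add_distrib, Finset.sum_pi_single', Finset.mem_univ,
      if_true]
    omega
  have hle : ∀ i, z i < N + 1 := fun i => by
    have := Finset.single_le_sum (f := z) (fun j _ => Nat.zero_le _) (Finset.mem_univ i)
    omega
  exact ⟨⟨fun i => ⟨z i, hle i⟩, hz⟩, fun i => Nat.le_add_right _ _⟩

/-- The point of the standard simplex given by a grid point. -/
def Grid.toSimplex {N : ℕ} (hN : 0 < N) (x : Grid I N) : stdSimplex ℝ I :=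
  ⟨fun i => ((x.1 i : ℕ) : ℝ) / N, fun _ => by positivity, by
    have : (N : ℝ) ≠ 0 := by positivity
    rw [← Finset.sum_div, ← Nat.cast_sum, x.2, div_self this]⟩

lemma Grid.toSimplex_apply {N : ℕ} (hN : 0 < N) (x : Grid I N) (i : I) :
    (x.toSimplex hN : I → ℝ) i = ((x.1 i : ℕ) : ℝ) / N := rfl

/-- Rankings of the grid points that refine the comparison of the `i`-th coordinates. -/
def gridRank (I : Type*) [Fintype I] [DecidableEq I] (N : ℕ) (i : I) (x : Grid I N) : ℕ :=
  (x.1 i : ℕ) * Fintype.card (Grid I N) + Fintype.equivFin (Grid I N) x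

variable [DecidableEq I]

lemma gridRank_lt {N : ℕ} {i : I} {x y : Grid I N} (h : (x.1 i : ℕ) < y.1 i) :
    gridRank I N i x < gridRank I N i y := by
  have h1 := (Fintype.equivFin (Grid I N) x).2
  have h2 : ((x.1 i : ℕ) + 1) * Fintype.card (Grid I N) ≤ (y.1 i : ℕ) * Fintype.card (Grid I N) :=
    Nat.mul_le_mul_right _ h
  rw [add_mul, one_mul] at h2
  unfold gridRank
  omega

lemma gridRank_injective (N : ℕ) (i : I) : Function.Injective (gridRank I N i) := by
  intro x y h
  rcases lt_trichotomy (x.1 i : ℕ) (y.1 i) with hlt | heq | hlt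
  · exact absurd h (gridRank_lt hlt).ne
  · unfold gridRank at h
    rw [heq] at h
    exact (Fintype.equivFin (Grid I N)).injective (Fin.ext (Nat.add_left_cancel h))
  · exact absurd h (gridRank_lt hlt).ne'

/-- If the coordinate minima over `σ`, for indices in `C`, could all be raised by one within the
total `N`, some grid point would violate dominance. So these minima add up to more than `N -
C.card`, which leaves each point of `σ` little room above them. -/
lemma exists_close_of_isDominant {N : ℕ} {σ : Finset (Grid I N)} {C : Finset I}
    (hσ : σ.Nonempty) (hC : C.Nonempty) (h : Scarf.IsDominant (gridRank I N) σ C) :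
    (∀ x ∈ σ, ∀ i ∉ C, (x.1 i : ℕ) ≤ Fintype.card I) ∧
      ∀ x ∈ σ, ∀ y ∈ σ, ∀ i, (x.1 i : ℕ) ≤ y.1 i + Fintype.card I := by
  have hmin : ∀ i, ∃ x ∈ σ, ∀ x' ∈ σ, (x.1 i : ℕ) ≤ x'.1 i := fun i =>
    σ.exists_min_image (fun x : Grid I N => (x.1 i : ℕ)) hσ
  choose f hfσ hf using hmin
  -- The value 0 outside `C` makes smallness of those coordinates an instance of the bound `hup`.
  let m : I → ℕ := fun i => if i ∈ C then ((f i).1 i : ℕ) else 0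
  have hsum : N < ∑ i, m i + C.card := by
    by_contra! hle
    obtain ⟨i₀, hi₀⟩ := hC
    obtain ⟨y, hy⟩ := exists_grid (N := N) (fun i => m i + if i ∈ C then 1 else 0) i₀ (by
      simpa [Finset.sum_add_distrib] using hle)
    obtain ⟨i, hi, hdom⟩ := h y
    have h1 := hy i
    simp only [m, hi, if_true] at h1
    exact absurd (hdom _ (hfσ i)) (not_le.2 (gridRank_lt h1))
  have hCI : C.card ≤ Fintype.card I := Finset.card_le_univ C
  have hm : ∀ x ∈ σ, ∀ i, m i ≤ x.1 i := fun x hx i => by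
    simp only [m]
    split_ifs
    · exact hf i x hx
    · exact Nat.zero_le _
  have hup : ∀ x ∈ σ, ∀ i, (x.1 i : ℕ) ≤ m i + Fintype.card I := fun x hx i => by
    have h1 := Finset.add_sum_erase Finset.univ (fun j => (x.1 j : ℕ)) (Finset.mem_univ i)
    have h2 := Finset.add_sum_erase Finset.univ m (Finset.mem_univ i)
    have h3 : ∑ j ∈ Finset.univ.erase i, m j ≤ ∑ j ∈ Finset.univ.erase i, (x.1 j : ℕ) :=
      Finset.sum_le_sum fun j _ => hm x hx j
    have h4 := x.2
    omega
  refine ⟨fun x hx i hi => ?_, fun x hx y hy i => (hup x hx i).trans ?_⟩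
  · have := hup x hx i
    simpa [m, hi] using this
  · exact Nat.add_le_add_right (hm y hy i) _

/-- Color a grid point by a coordinate that `f` does not decrease, which exists because both sums
are 1. A colorful room has a nearby point of each color in `C`; for `i` outside `C` the coordinate
is itself small. -/
lemma exists_approx [Nonempty I] (f : stdSimplex ℝ I → stdSimplex ℝ I) {N : ℕ} (hN : 0 < N) :
    ∃ p : stdSimplex ℝ I, ∀ i, ∃ q : stdSimplex ℝ I,
      (∀ j, |(q : I → ℝ) j - (p : I → ℝ) j| ≤ (Fintype.card I : ℝ) / N) ∧
        (q : I → ℝ) i ≤ (f q : I → ℝ) i + (Fintype.card I : ℝ) / N := by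
  have hcol : ∀ x : Grid I N, ∃ i, (x.toSimplex hN : I → ℝ) i ≤ (f (x.toSimplex hN) : I → ℝ) i := by
    intro x
    by_contra! h
    have := Finset.sum_lt_sum_of_nonempty (Finset.univ_nonempty (α := I)) fun i _ => h i
    rw [stdSimplex.sum_eq_one, stdSimplex.sum_eq_one] at this
    exact lt_irrefl _ this
  choose c hc using hcol
  have : Nonempty (Grid I N) :=
    ⟨(exists_grid (N := N) (fun _ : I => 0) (Classical.arbitrary I) (by simp)).choose⟩
  obtain ⟨σ, C, hdom, himg⟩ := Scarf.exists_colorful (gridRank_injective (I := I) N) c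
  have hC : C.Nonempty := by
    obtain ⟨i, hi, -⟩ := hdom (Classical.arbitrary _)
    exact ⟨i, hi⟩
  have hσ : σ.Nonempty := by
    rw [← himg] at hC
    exact Finset.image_nonempty.1 hC
  obtain ⟨h1, h2⟩ := exists_close_of_isDominant hσ hC hdom
  have hN' : (0 : ℝ) < N := by exact_mod_cast hN
  obtain ⟨x₀, hx₀⟩ := hσ
  refine ⟨x₀.toSimplex hN, fun i => ?_⟩
  by_cases hi : i ∈ C
  · obtain ⟨x, hx, rfl⟩ := Finset.mem_image.1 (himg.symm ▸ hi)
    refine ⟨x.toSimplex hN, fun j => ?_, (hc x).trans (le_add_of_nonneg_right (by positivity))⟩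
    have h3 : ((x.1 j : ℕ) : ℝ) ≤ (x₀.1 j : ℕ) + Fintype.card I := by
      exact_mod_cast h2 x hx x₀ hx₀ j
    have h4 : ((x₀.1 j : ℕ) : ℝ) ≤ (x.1 j : ℕ) + Fintype.card I := by
      exact_mod_cast h2 x₀ hx₀ x hx j
    rw [Grid.toSimplex_apply, Grid.toSimplex_apply, ← sub_div, abs_div, abs_of_pos hN']
    gcongr
    exact abs_le.2 ⟨by linarith, by linarith⟩
  · refine ⟨x₀.toSimplex hN, fun j => by simp only [sub_self, abs_zero]; positivity, ?_⟩
    have h3 : ((x₀.1 i : ℕ) : ℝ) ≤ Fintype.card I := by exact_mod_cast h1 x₀ hx₀ i hi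
    have h4 := (f (x₀.toSimplex hN)).2.1 i
    have h5 : (x₀.toSimplex hN : I → ℝ) i ≤ (Fintype.card I : ℝ) / N := by
      rw [Grid.toSimplex_apply]; gcongr
    exact h5.trans (le_add_of_nonneg_left h4)

/-- **Brouwer's fixed point theorem** for the standard simplex. -/
theorem exists_fixedPoint_stdSimplex [Nonempty I] (f : stdSimplex ℝ I → stdSimplex ℝ I)
    (hf : Continuous f) : ∃ x, f x = x := by
  choose p q hq hqf using fun n : ℕ => exists_approx f n.succ_pos
  obtain ⟨x, φ, hφ, hx⟩ := CompactSpace.tendsto_subseq p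
  have hε : Filter.Tendsto (fun n => (Fintype.card I : ℝ) / ((φ n).succ : ℕ)) Filter.atTop
      (nhds 0) := by
    have := (tendsto_const_div_atTop_nhds_zero_nat (Fintype.card I : ℝ)).comp
      ((Filter.tendsto_add_atTop_nat 1).comp hφ.tendsto_atTop)
    exact this
  have hqx : ∀ i, Filter.Tendsto (fun n => q (φ n) i) Filter.atTop (nhds x) := by
    intro i
    rw [tendsto_subtype_rng, tendsto_pi_nhds]
    intro j
    have hpj : Filter.Tendsto (fun n => (p (φ n) : I → ℝ) j) Filter.atTop (nhds ((x : I → ℝ) j)) :=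
      ((continuous_stdSimplex_apply j).tendsto x).comp hx
    have hdiff : Filter.Tendsto (fun n => (q (φ n) i : I → ℝ) j - (p (φ n) : I → ℝ) j)
        Filter.atTop (nhds 0) := squeeze_zero_norm (fun n => hq (φ n) i j) hε
    have h := hdiff.add hpj
    simp only [sub_add_cancel, zero_add] at h
    exact h
  have hle : ∀ i, (x : I → ℝ) i ≤ (f x : I → ℝ) i := by
    intro i
    have hev := continuous_stdSimplex_apply i
    have h1 := (hev.tendsto x).comp (hqx i)
    have h2 := (((hev.comp hf).tendsto x).comp (hqx i)).add hε
    rw [add_zero] at h2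
    exact le_of_tendsto_of_tendsto' h1 h2 fun n => hqf (φ n) i
  refine ⟨x, stdSimplex.ext (funext fun i => ?_)⟩
  -- Both points have coordinate sum 1, so the coordinatewise inequality is an equality.
  have := (Finset.sum_eq_sum_iff_of_le fun i (_ : i ∈ Finset.univ) => hle i).1
    (by rw [stdSimplex.sum_eq_one, stdSimplex.sum_eq_one])
  exact (this i (Finset.mem_univ i)).symm

/-! ### From one simplex to a product of simplices. -/

variable {S A : Type*} [Fintype S] [Fintype A]

/-- A retraction of the nonnegative vectors onto the standard simplex. -/
def retract [Nonempty A] (v : A → ℝ) (hv : ∀ a, 0 ≤ v a) : stdSimplex ℝ A :=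
  -- A deficit of mass is spread uniformly and an excess is scaled away, so the denominator is at
  -- least 1.
  ⟨fun a => (v a + max 0 (1 - ∑ b, v b) / Fintype.card A) / max 1 (∑ b, v b),
    fun a => div_nonneg (add_nonneg (hv a) (by positivity)) (by positivity), by
      have h : (Fintype.card A : ℝ) ≠ 0 := by exact_mod_cast Fintype.card_ne_zero
      rw [← Finset.sum_div, Finset.sum_add_distrib, Finset.sum_const, Finset.card_univ,
        nsmul_eq_mul, mul_div_cancel₀ _ h]
      rw [div_eq_one_iff_eq (by positivity)]
      rcases le_total 1 (∑ b, v b) with h1 | h1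
      · rw [max_eq_left (by linarith), max_eq_right h1, add_zero]
      · rw [max_eq_right (by linarith), max_eq_left h1]; ring⟩

/-- **Brouwer's fixed point theorem** for products of standard simplices. -/
theorem exists_fixedPoint_pi_stdSimplex [Nonempty A]
    (f : (S → stdSimplex ℝ A) → S → stdSimplex ℝ A) (hf : Continuous f) : ∃ x, f x = x := by
  classical
  rcases isEmpty_or_nonempty S with hS | hS
  · exact ⟨fun s => isEmptyElim s, Subsingleton.elim _ _⟩
  have hcS : (0 : ℝ) < Fintype.card S := by exact_mod_cast Fintype.card_pos
  -- The product is a retract of the simplex on `S × A`: with `r ∘ e = id`, a fixed point of `e ∘ f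
  -- ∘ r` is carried by `r` to one of `f`.
  let r : stdSimplex ℝ (S × A) → S → stdSimplex ℝ A := fun x s =>
    retract (fun a => Fintype.card S * (x : S × A → ℝ) (s, a))
      fun a => mul_nonneg hcS.le (stdSimplex.zero_le _ _)
  let e : (S → stdSimplex ℝ A) → stdSimplex ℝ (S × A) := fun π =>
    ⟨fun z => (π z.1 : A → ℝ) z.2 / Fintype.card S, fun z => div_nonneg (stdSimplex.zero_le _ _) hcS.le, by
      rw [← Finset.sum_div, Fintype.sum_prod_type]
      simp only [stdSimplex.sum_eq_one]
      simp [hcS.ne']⟩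
  have hr : Continuous r := by
    refine continuous_pi fun s => Continuous.subtype_mk (continuous_pi fun a => ?_) _
    have h : ∀ b, Continuous fun x : stdSimplex ℝ (S × A) => (Fintype.card S : ℝ) * x (s, b) :=
      fun b => continuous_const.mul (continuous_stdSimplex_apply (s, b))
    have hs := continuous_finsetSum Finset.univ fun b _ => h b
    exact Continuous.div ((h a).add ((continuous_const.max (continuous_const.sub hs)).div_const _))
      (continuous_const.max hs) fun x => by positivity
  have he : Continuous e := by
    refine Continuous.subtype_mk (continuous_pi fun z => ?_) _
    exact ((continuous_stdSimplex_apply z.2).comp (continuous_apply z.1)).div_const _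
  have hre : ∀ π, r (e π) = π := by
    intro π
    funext s
    refine stdSimplex.ext (funext fun a => ?_)
    have h : ∀ b, (Fintype.card S : ℝ) * ((π s : A → ℝ) b / Fintype.card S) = (π s : A → ℝ) b :=
      fun b => mul_div_cancel₀ _ hcS.ne'
    have hsum : ∑ b, (Fintype.card S : ℝ) * ((π s : A → ℝ) b / Fintype.card S) = 1 := by
      simp only [h, stdSimplex.sum_eq_one]
    change (Fintype.card S * ((π s : A → ℝ) a / Fintype.card S) + max 0 (1 - ∑ b,
      (Fintype.card S : ℝ) * ((π s : A → ℝ) b / Fintype.card S)) / Fintype.card A) /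
        max 1 (∑ b, (Fintype.card S : ℝ) * ((π s : A → ℝ) b / Fintype.card S)) = π s a
    rw [hsum, h]
    simp
  obtain ⟨x, hx⟩ := exists_fixedPoint_stdSimplex (fun x => e (f (r x))) (he.comp (hf.comp hr))
  refine ⟨r x, ?_⟩
  conv_rhs => rw [← hx, hre]

end Brouwer

end

noncomputable section

/-! ### Resolvents of stochastic matrices -/

namespace PerformativeMDP

open PerformativeRL

section Resolvent

variable {S : Type*} [Fintype S] [DecidableEq S]

/-- The discounted resolvent `∑ n, γ ^ n • K ^ n` of a matrix, entry by entry. -/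
def resolvent (γ : ℝ) (K : Matrix S S ℝ) (s s' : S) : ℝ := ∑' n : ℕ, γ ^ n * (K ^ n) s s'

variable {γ : ℝ} {K : Matrix S S ℝ}

lemma norm_resolvent_term_le (h0 : 0 ≤ γ) (hK : K ∈ Matrix.rowStochastic ℝ S) (n : ℕ) (s s' : S) :
    ‖γ ^ n * (K ^ n) s s'‖ ≤ γ ^ n := by
  have hn := pow_mem hK n
  have h1 := Matrix.nonneg_of_mem_rowStochastic hn (i := s) (j := s')
  have h2 := Matrix.le_one_of_mem_rowStochastic hn (i := s) (j := s')
  rw [Real.norm_of_nonneg (by positivity)]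
  exact mul_le_of_le_one_right (by positivity) h2

lemma summable_resolvent (h0 : 0 ≤ γ) (h1 : γ < 1) (hK : K ∈ Matrix.rowStochastic ℝ S) (s s' : S) :
    Summable fun n : ℕ => γ ^ n * (K ^ n) s s' :=
  Summable.of_norm_bounded (summable_geometric_of_lt_one h0 h1)
    fun n => norm_resolvent_term_le h0 hK n s s'

lemma resolvent_nonneg (h0 : 0 ≤ γ) (hK : K ∈ Matrix.rowStochastic ℝ S) (s s' : S) :
    0 ≤ resolvent γ K s s' :=
  tsum_nonneg fun n => mul_nonneg (pow_nonneg h0 n)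
    (Matrix.nonneg_of_mem_rowStochastic (pow_mem hK n))

lemma resolvent_eq_left (h0 : 0 ≤ γ) (h1 : γ < 1) (hK : K ∈ Matrix.rowStochastic ℝ S) (s s' : S) :
    resolvent γ K s s' = (1 : Matrix S S ℝ) s s' + γ * ∑ k, K s k * resolvent γ K k s' := by
  have hs := fun k => summable_resolvent h0 h1 hK k s'
  unfold resolvent
  rw [(hs s).tsum_eq_zero_add, pow_zero, pow_zero, one_mul]
  congr 1
  simp_rw [← tsum_mul_left]
  rw [← Summable.tsum_finsetSum fun k _ => (hs k).mul_left _, ← tsum_mul_left]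
  refine tsum_congr fun n => ?_
  rw [pow_succ' K, Matrix.mul_apply, Finset.mul_sum, Finset.mul_sum]
  exact Finset.sum_congr rfl fun k _ => by ring

lemma resolvent_eq_right (h0 : 0 ≤ γ) (h1 : γ < 1) (hK : K ∈ Matrix.rowStochastic ℝ S)
    (s s' : S) :
    resolvent γ K s s' = (1 : Matrix S S ℝ) s s' + γ * ∑ k, resolvent γ K s k * K k s' := by
  have hs := fun k => summable_resolvent h0 h1 hK s k
  unfold resolvent
  rw [(hs s').tsum_eq_zero_add, pow_zero, pow_zero, one_mul]
  congr 1
  simp_rw [← tsum_mul_right]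
  rw [← Summable.tsum_finsetSum fun k _ => (hs k).mul_right _, ← tsum_mul_left]
  refine tsum_congr fun n => ?_
  rw [pow_succ K, Matrix.mul_apply, Finset.mul_sum, Finset.mul_sum]
  exact Finset.sum_congr rfl fun k _ => by ring

lemma continuous_resolvent {X : Type*} [TopologicalSpace X] {K : X → Matrix S S ℝ} (h0 : 0 ≤ γ)
    (h1 : γ < 1) (hK : ∀ x, K x ∈ Matrix.rowStochastic ℝ S) (hc : Continuous K) (s s' : S) :
    Continuous fun x => resolvent γ (K x) s s' :=
  continuous_tsum (fun n => continuous_const.mul ((hc.pow n).matrix_elem s s'))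
    (summable_geometric_of_lt_one h0 h1) fun n x => norm_resolvent_term_le h0 (hK x) n s s'

end Resolvent

/-! ### Occupancy measures and values of policies -/

variable {S A : Type*} [Fintype S] [Fintype A]

/-- The transition matrix between states under a policy. -/
def stateMatrix (π : Policy S A) (P : TransitionFunction S A) : Matrix S S ℝ :=
  fun s s' => ∑ a, π s a * P s a s'

lemma continuous_stateMatrix {X : Type*} [TopologicalSpace X] {π : X → Policy S A}
    {P : X → TransitionFunction S A} (hπ : Continuous π) (hP : Continuous P) :
    Continuous fun x => stateMatrix (π x) (P x) := by
  refine continuous_matrix fun s s' => continuous_finsetSum _ fun a _ => ?_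
  exact ((Brouwer.continuous_stdSimplex_apply a).comp ((continuous_apply s).comp hπ)).mul
    ((Brouwer.continuous_stdSimplex_apply s').comp
      ((continuous_apply a).comp ((continuous_apply s).comp hP)))

variable [DecidableEq S]

lemma stateMatrix_mem (π : Policy S A) (P : TransitionFunction S A) :
    stateMatrix π P ∈ Matrix.rowStochastic ℝ S := by
  rw [Matrix.mem_rowStochastic_iff_sum]
  refine ⟨fun s s' => Finset.sum_nonneg fun a _ => mul_nonneg (stdSimplex.zero_le _ _)
    (stdSimplex.zero_le _ _), fun s => ?_⟩
  unfold stateMatrix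
  rw [Finset.sum_comm]
  simp_rw [← Finset.mul_sum, stdSimplex.sum_eq_one, mul_one]
  exact stdSimplex.sum_eq_one _

variable (M : PerformativeMDP S A)

/-- The discounted number of visits to a state. -/
def stateOccupancy (π : Policy S A) (P : TransitionFunction S A) (s : S) : ℝ :=
  ∑ k, M.ρ k * resolvent M.γ (stateMatrix π P) k s

/-- The occupancy measure of a policy in the environment with transition function `P`. -/
def occupancy (π : Policy S A) (P : TransitionFunction S A) (z : S × A) : ℝ :=
  M.stateOccupancy π P z.1 * π z.1 z.2

/-- The discounted value of a policy in a fixed environment. -/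
def value (π : Policy S A) (P : TransitionFunction S A) (r : S × A → ℝ) (s : S) : ℝ :=
  ∑ k, resolvent M.γ (stateMatrix π P) s k * ∑ a, π k a * r (k, a)

/-- The advantage of an action over a policy in a fixed environment. -/
def advantage (π : Policy S A) (P : TransitionFunction S A) (r : S × A → ℝ) (s : S) (a : A) : ℝ :=
  r (s, a) + M.γ * ∑ s', P s a s' * M.value π P r s' - M.value π P r s

lemma stateOccupancy_nonneg (π : Policy S A) (P : TransitionFunction S A) (s : S) :
    0 ≤ M.stateOccupancy π P s :=
  Finset.sum_nonneg fun k _ => mul_nonneg (stdSimplex.zero_le _ _)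
    (resolvent_nonneg M.γ_nonneg (stateMatrix_mem π P) k s)

lemma sum_occupancy (π : Policy S A) (P : TransitionFunction S A) (s : S) :
    ∑ a, M.occupancy π P (s, a) = M.stateOccupancy π P s := by
  simp only [occupancy, ← Finset.mul_sum, stdSimplex.sum_eq_one, mul_one]

lemma stateOccupancy_eq (π : Policy S A) (P : TransitionFunction S A) (s : S) :
    M.stateOccupancy π P s =
      M.ρ s + M.γ * ∑ s', M.stateOccupancy π P s' * stateMatrix π P s' s := by
  conv_lhs => unfold stateOccupancy
  simp_rw [fun k => resolvent_eq_right M.γ_nonneg M.γ_lt_one (stateMatrix_mem π P) k s]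
  simp only [mul_add, Finset.sum_add_distrib, stateOccupancy]
  congr 1
  · simp [Matrix.one_apply]
  · simp only [Finset.mul_sum, Finset.sum_mul]
    rw [Finset.sum_comm]
    exact Finset.sum_congr rfl fun _ _ => Finset.sum_congr rfl fun _ _ => by ring

lemma occupancy_mem (π : Policy S A) (P : TransitionFunction S A) :
    M.occupancy π P ∈ M.occupancyPolytope P := by
  refine ⟨fun z => mul_nonneg (M.stateOccupancy_nonneg _ _ _) (stdSimplex.zero_le _ _),
    fun s => ?_⟩
  rw [sum_occupancy, stateOccupancy_eq]
  congr 2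
  refine Finset.sum_congr rfl fun s' _ => ?_
  simp only [stateMatrix, Finset.mul_sum, occupancy]
  exact Finset.sum_congr rfl fun a _ => by ring

lemma value_eq (π : Policy S A) (P : TransitionFunction S A) (r : S × A → ℝ) (s : S) :
    M.value π P r s =
      ∑ a, π s a * r (s, a) + M.γ * ∑ k, stateMatrix π P s k * M.value π P r k := by
  conv_lhs => unfold value
  simp_rw [fun k => resolvent_eq_left M.γ_nonneg M.γ_lt_one (stateMatrix_mem π P) s k]
  simp only [add_mul, Finset.sum_add_distrib, value]
  congr 1
  · simp [Matrix.one_apply]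
  · simp only [Finset.mul_sum, Finset.sum_mul]
    refine (Finset.sum_congr rfl fun _ _ => Finset.sum_comm).trans ?_
    rw [Finset.sum_comm]
    exact Finset.sum_congr rfl fun _ _ => Finset.sum_congr rfl fun _ _ =>
      Finset.sum_congr rfl fun _ _ => by ring

lemma sum_policy_mul_advantage (π : Policy S A) (P : TransitionFunction S A) (r : S × A → ℝ)
    (s : S) : ∑ a, π s a * M.advantage π P r s a = 0 := by
  have h : ∑ a, π s a * M.advantage π P r s a = ∑ a, π s a * r (s, a) +
      M.γ * ∑ k, stateMatrix π P s k * M.value π P r k - M.value π P r s := by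
    simp only [advantage, mul_sub, mul_add, Finset.sum_sub_distrib, Finset.sum_add_distrib,
      ← Finset.sum_mul, stdSimplex.sum_eq_one, one_mul]
    congr 2
    simp only [stateMatrix, Finset.mul_sum, Finset.sum_mul]
    rw [Finset.sum_comm]
    exact Finset.sum_congr rfl fun _ _ => Finset.sum_congr rfl fun _ _ => by ring
  rw [h, ← value_eq, sub_self]

/-- Pair the flow equations of `y` with the value function of `π`, which acts as the dual variable:
the objective becomes a constant independent of `y` plus the advantages weighted by `y`. -/
lemma sum_mul_reward_eq {P : TransitionFunction S A} {y : S × A → ℝ}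
    (hy : y ∈ M.occupancyPolytope P) (π : Policy S A) (r : S × A → ℝ) :
    ∑ s, ∑ a, y (s, a) * r (s, a) =
      ∑ s, M.ρ s * M.value π P r s + ∑ s, ∑ a, y (s, a) * M.advantage π P r s a := by
  have h2 : ∑ s, (∑ a, y (s, a)) * M.value π P r s = ∑ s, M.ρ s * M.value π P r s +
      M.γ * ∑ s, ∑ a, y (s, a) * ∑ s', P s a s' * M.value π P r s' := by
    simp only [hy.2, add_mul, Finset.sum_add_distrib]
    congr 1
    simp only [Finset.mul_sum, Finset.sum_mul]
    rw [Finset.sum_comm]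
    refine Finset.sum_congr rfl fun s' _ => ?_
    rw [Finset.sum_comm]
    exact Finset.sum_congr rfl fun _ _ => Finset.sum_congr rfl fun _ _ => by ring
  have h1 : ∑ s, ∑ a, y (s, a) * M.advantage π P r s a = ∑ s, ∑ a, y (s, a) * r (s, a) +
      M.γ * (∑ s, ∑ a, y (s, a) * ∑ s', P s a s' * M.value π P r s') -
        ∑ s, (∑ a, y (s, a)) * M.value π P r s := by
    simp only [advantage, mul_sub, mul_add, Finset.sum_sub_distrib, Finset.sum_add_distrib,
      Finset.sum_mul]
    congr 2
    rw [Finset.mul_sum]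
    refine Finset.sum_congr rfl fun _ _ => ?_
    rw [Finset.mul_sum]
    exact Finset.sum_congr rfl fun _ _ => by ring
  rw [h1, h2]; ring

/-- Complementary slackness: the advantages weighted by the occupancy measure of `π` add up to 0,
and for any feasible `y` they add up to at most 0. -/
lemma isMaxOn_occupancy {π : Policy S A} {P : TransitionFunction S A} {r : S × A → ℝ}
    (h : ∀ s a, M.advantage π P r s a ≤ 0) :
    IsMaxOn (fun y : S × A → ℝ => ∑ s, ∑ a, y (s, a) * r (s, a)) (M.occupancyPolytope P)
      (M.occupancy π P) := by
  intro y hy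
  change ∑ s, ∑ a, y (s, a) * r (s, a) ≤ ∑ s, ∑ a, M.occupancy π P (s, a) * r (s, a)
  rw [M.sum_mul_reward_eq hy π, M.sum_mul_reward_eq (M.occupancy_mem π P) π]
  have h0 : ∑ s, ∑ a, M.occupancy π P (s, a) * M.advantage π P r s a = 0 := by
    simp only [occupancy, mul_assoc, ← Finset.mul_sum, sum_policy_mul_advantage, mul_zero,
      Finset.sum_const_zero]
  rw [h0]
  gcongr
  exact Finset.sum_nonpos fun s _ => Finset.sum_nonpos fun a _ =>
    mul_nonpos_of_nonneg_of_nonpos (hy.1 _) (h s a)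

/-! ### Continuity -/

variable {X : Type*} [TopologicalSpace X] {π : X → Policy S A} {P : X → TransitionFunction S A}

omit [Fintype S] [DecidableEq S] in
lemma continuous_policy_apply (hπ : Continuous π) (s : S) (a : A) :
    Continuous fun x => π x s a :=
  (Brouwer.continuous_stdSimplex_apply a).comp ((continuous_apply s).comp hπ)

lemma continuous_resolvent_stateMatrix (hπ : Continuous π) (hP : Continuous P) (s s' : S) :
    Continuous fun x => resolvent M.γ (stateMatrix (π x) (P x)) s s' :=
  continuous_resolvent M.γ_nonneg M.γ_lt_one (fun x => stateMatrix_mem (π x) (P x))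
    (continuous_stateMatrix hπ hP) s s'

lemma continuous_occupancy (hπ : Continuous π) (hP : Continuous P) :
    Continuous fun x => M.occupancy (π x) (P x) :=
  continuous_pi fun z => (continuous_finsetSum _ fun k _ => continuous_const.mul
    (M.continuous_resolvent_stateMatrix hπ hP k z.1)).mul (continuous_policy_apply hπ z.1 z.2)

lemma continuous_value {r : X → S × A → ℝ} (hπ : Continuous π) (hP : Continuous P)
    (hr : Continuous r) (s : S) : Continuous fun x => M.value (π x) (P x) (r x) s :=
  continuous_finsetSum _ fun k _ => (M.continuous_resolvent_stateMatrix hπ hP s k).mul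
    (continuous_finsetSum _ fun a _ => (continuous_policy_apply hπ k a).mul
      ((continuous_apply (k, a)).comp hr))

lemma continuous_advantage {r : X → S × A → ℝ} (hπ : Continuous π) (hP : Continuous P)
    (hr : Continuous r) (s : S) (a : A) :
    Continuous fun x => M.advantage (π x) (P x) (r x) s a :=
  (((continuous_apply (s, a)).comp hr).add (continuous_const.mul
    (continuous_finsetSum _ fun s' _ => ((Brouwer.continuous_stdSimplex_apply s').comp
      ((continuous_apply a).comp ((continuous_apply s).comp hP))).mul
        (M.continuous_value hπ hP hr s')))).sub (M.continuous_value hπ hP hr s)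

end PerformativeMDP

end

noncomputable section

/-! ### Performatively stable occupancy measures -/

namespace PerformativeMDP

open PerformativeRL

lemma abs_le_l2Norm {ι : Type*} [Fintype ι] (x : ι → ℝ) (i : ι) : |x i| ≤ l2Norm x :=
  Real.abs_le_sqrt (Finset.single_le_sum (f := fun i => x i ^ 2) (fun _ _ => sq_nonneg _)
    (Finset.mem_univ i))

lemma continuous_l2Norm {ι : Type*} [Fintype ι] : Continuous (l2Norm : (ι → ℝ) → ℝ) :=
  Real.continuous_sqrt.comp
    (continuous_finsetSum _ fun i _ => (continuous_apply i).pow 2)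

/-- A real function whose increments are controlled by the Euclidean increments of a continuous
vector-valued function is continuous. -/
lemma continuous_of_le_l2Norm {X ι : Type*} [TopologicalSpace X] [Fintype ι] {f : X → ℝ}
    {g : X → ι → ℝ} (hg : Continuous g) {c : ℝ}
    (h : ∀ x y, |f x - f y| ≤ c * l2Norm (fun i => g x i - g y i)) : Continuous f := by
  refine continuous_iff_continuousAt.2 fun y => ?_
  have hc : Continuous fun x => c * l2Norm (fun i => g x i - g y i) :=
    continuous_const.mul (continuous_l2Norm.comp
      (continuous_pi fun i => ((continuous_apply i).comp hg).sub continuous_const))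
  have := hc.tendsto y
  rw [show c * l2Norm (fun i => g y i - g y i) = 0 by simp [l2Norm]] at this
  exact tendsto_iff_dist_tendsto_zero.2 (squeeze_zero (fun _ => dist_nonneg)
    (fun x => by rw [Real.dist_eq]; exact h x y) this)

variable {S A : Type*} [Fintype S] [Fintype A] [Nonempty A] {M : PerformativeMDP S A} {εr εp : ℝ}

lemma IsSensitive.continuous_rewardOf (hM : M.IsSensitive εr εp) {X : Type*} [TopologicalSpace X]
    {g : X → S × A → ℝ} (hg : Continuous g) (hocc : ∀ x, M.IsOccupancyMeasure (g x)) :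
    Continuous fun x => M.rewardOf (g x) :=
  continuous_pi fun z => continuous_of_le_l2Norm hg fun x y =>
    (abs_le_l2Norm (fun z => M.rewardOf (g x) z - M.rewardOf (g y) z) z).trans
      (hM (g x) (g y) (hocc x) (hocc y)).1

lemma IsSensitive.continuous_transitionOf (hM : M.IsSensitive εr εp) {X : Type*}
    [TopologicalSpace X] {g : X → S × A → ℝ} (hg : Continuous g)
    (hocc : ∀ x, M.IsOccupancyMeasure (g x)) : Continuous fun x => M.transitionOf (g x) :=
  continuous_pi fun s => continuous_pi fun a => continuous_induced_rng.2 <| continuous_pi fun s' =>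
    continuous_of_le_l2Norm hg fun x y =>
      (abs_le_l2Norm (fun z : S × A × S => M.transitionOf (g x) z.1 z.2.1 z.2.2 -
        M.transitionOf (g y) z.1 z.2.1 z.2.2) (s, a, s')).trans
          (hM (g x) (g y) (hocc x) (hocc y)).2

/-- A continuous real function with finite range on a connected space is constant. -/
lemma eq_of_finite_range {X : Type*} [TopologicalSpace X] [PreconnectedSpace X] {f : X → ℝ}
    (hf : Continuous f) (hfin : (Set.range f).Finite) (x y : X) : f x = f y :=
  isPreconnected_univ.constant_of_mapsTo hfin.isDiscrete hf.continuousOn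
    (fun z _ => Set.mem_range_self z) (Set.mem_univ x) (Set.mem_univ y)

/-! ### Policies induced by occupancy measures, and the environments they meet. -/

variable [DecidableEq S]

open Classical in
lemma inducedPolicy_occupancy (π : Policy S A) (P : TransitionFunction S A) :
    inducedPolicy (M.occupancy π P) =
      fun s => if 0 < M.stateOccupancy π P s then π s else uniformDist A := by
  funext s
  have hnn := (M.occupancy_mem π P).1
  unfold inducedPolicy
  by_cases h : 0 < M.stateOccupancy π P s
  · rw [dif_pos ⟨fun a => hnn (s, a), by rwa [sum_occupancy]⟩, if_pos h]
    refine stdSimplex.ext (funext fun a => ?_)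
    change M.occupancy π P (s, a) / ∑ b, M.occupancy π P (s, b) = π s a
    rw [sum_occupancy, occupancy, mul_div_cancel_left₀ _ h.ne']
  · rw [dif_neg (fun h' => h (by simpa only [sum_occupancy] using h'.2)), if_neg h]

/-- The default at unvisited states is uniform as well. This is why the response to the uniform
policy serves as base environment. -/
lemma inducedPolicy_occupancy_uniform (P : TransitionFunction S A) :
    inducedPolicy (M.occupancy (fun _ => uniformDist A) P) = fun _ => uniformDist A := by
  rw [inducedPolicy_occupancy]
  simp

/-- The policies induced by the occupancy measures of one policy depend only on which states are
visited. -/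
lemma finite_range_inducedPolicy (π : Policy S A) :
    (Set.range fun P => inducedPolicy (M.occupancy π P)).Finite := by
  classical
  refine (Set.finite_range fun (B : Set S) (s : S) => if s ∈ B then π s else uniformDist A).subset ?_
  rintro _ ⟨P, rfl⟩
  exact ⟨{s | 0 < M.stateOccupancy π P s}, by simp only [inducedPolicy_occupancy]; rfl⟩

variable (M) in
/-- The occupancy measure of a policy in the environment that responds to the uniform policy. -/
def baseOccupancy (π : Policy S A) : S × A → ℝ :=
  M.occupancy π (M.transition fun _ => uniformDist A)

lemma isOccupancyMeasure_baseOccupancy (π : Policy S A) :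
    M.IsOccupancyMeasure (M.baseOccupancy π) :=
  ⟨_, M.occupancy_mem _ _⟩

lemma isOccupancyMeasure_occupancy_transitionOf (π : Policy S A) (d : S × A → ℝ) :
    M.IsOccupancyMeasure (M.occupancy π (M.transitionOf d)) :=
  ⟨inducedPolicy d, M.occupancy_mem _ _⟩

lemma continuous_baseOccupancy : Continuous fun π => M.baseOccupancy π :=
  M.continuous_occupancy continuous_id continuous_const

lemma transitionOf_baseOccupancy_uniform :
    M.transitionOf (M.baseOccupancy fun _ => uniformDist A) =
      M.transition fun _ => uniformDist A := by
  rw [transitionOf, baseOccupancy, inducedPolicy_occupancy_uniform]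

/-- A policy meets the same environment through its occupancy measure in the base environment and
through its occupancy measure in the environment responding to the former. -/
lemma IsSensitive.environment_eq (hM : M.IsSensitive εr εp) (π : Policy S A) :
    M.rewardOf (M.occupancy π (M.transitionOf (M.baseOccupancy π))) =
        M.rewardOf (M.baseOccupancy π) ∧
      M.transitionOf (M.occupancy π (M.transitionOf (M.baseOccupancy π))) =
        M.transitionOf (M.baseOccupancy π) := by
  let g : Policy S A → S × A → ℝ := fun π' => M.occupancy π (M.transitionOf (M.baseOccupancy π'))
  have hg : Continuous g := M.continuous_occupancy continuous_const
    (hM.continuous_transitionOf continuous_baseOccupancy isOccupancyMeasure_baseOccupancy)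
  have hocc : ∀ π', M.IsOccupancyMeasure (g π') := fun π' =>
    isOccupancyMeasure_occupancy_transitionOf π _
  have hg0 : g (fun _ => uniformDist A) = M.baseOccupancy π := by
    simp only [g, transitionOf_baseOccupancy_uniform]
    rfl
  -- `F` stands for one entry of the reward or transition response. Only its composite along `g` has
  -- to be continuous, and sensitivity gives that.
  have key : ∀ F : Policy S A → ℝ, Continuous (fun π' => F (inducedPolicy (g π'))) →
      F (inducedPolicy (g π)) = F (inducedPolicy (M.baseOccupancy π)) := by
    intro F hF
    rw [← hg0]
    refine eq_of_finite_range hF (((finite_range_inducedPolicy (M := M) π).image F).subset ?_) _ _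
    rintro _ ⟨π', rfl⟩
    exact ⟨_, ⟨_, rfl⟩, rfl⟩
  refine ⟨funext fun z => key (fun π' => M.reward π' z)
      ((continuous_apply z).comp (hM.continuous_rewardOf hg hocc)),
    funext fun s => funext fun a => stdSimplex.ext (funext fun s' =>
      key (fun π' => M.transition π' s a s') ?_)⟩
  exact (Brouwer.continuous_stdSimplex_apply s').comp ((continuous_apply a).comp
    ((continuous_apply s).comp (hM.continuous_transitionOf hg hocc)))

/-! ### Nash's improvement map and its fixed point. -/

/-- The improvement of a probability vector `p` by nonnegative weights `w`. -/
def improve (p : stdSimplex ℝ A) (w : A → ℝ) : stdSimplex ℝ A :=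
  ⟨fun a => (p a + max 0 (w a)) / (1 + ∑ b, max 0 (w b)),
    fun a => div_nonneg (add_nonneg (stdSimplex.zero_le _ _) (le_max_left _ _))
      (add_nonneg zero_le_one (Finset.sum_nonneg fun b _ => le_max_left _ _)), by
    have h : 0 ≤ ∑ b, max 0 (w b) := Finset.sum_nonneg fun b _ => le_max_left _ _
    rw [← Finset.sum_div, Finset.sum_add_distrib, stdSimplex.sum_eq_one, div_self (by positivity)]⟩

omit [Nonempty A] in
-- At a fixed point the positive parts of `w` are proportional to `p`. Pairing them with `w` gives 0
-- by `hw`, yet that pairing is the sum of the squared positive parts.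
lemma nonpos_of_improve_eq {p : stdSimplex ℝ A} {w : A → ℝ} (h : improve p w = p)
    (hw : ∑ a, p a * w a = 0) (a : A) : w a ≤ 0 := by
  have hnn : 0 ≤ ∑ b, max 0 (w b) := Finset.sum_nonneg fun b _ => le_max_left _ _
  have hp : ∀ b, max 0 (w b) = p b * ∑ b, max 0 (w b) := fun b => by
    have h1 : (p b + max 0 (w b)) / (1 + ∑ b, max 0 (w b)) = p b :=
      congrArg (fun q : stdSimplex ℝ A => q b) h
    rw [div_eq_iff (by positivity)] at h1
    linarith
  have hsq : ∑ b, max 0 (w b) * w b = 0 := by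
    have : ∑ b, max 0 (w b) * w b = (∑ b, p b * w b) * ∑ b, max 0 (w b) := by
      rw [Finset.sum_mul]
      refine Finset.sum_congr rfl fun b _ => ?_
      rw [hp b]; ring
    rw [this, hw, zero_mul]
  have hterm : ∀ b, 0 ≤ max 0 (w b) * w b := fun b => by
    rcases le_total 0 (w b) with hb | hb
    · rw [max_eq_right hb]; exact mul_self_nonneg _
    · rw [max_eq_left hb, zero_mul]
  have := (Finset.sum_eq_zero_iff_of_nonneg fun b _ => hterm b).1 hsq a (Finset.mem_univ a)
  by_contra! ha
  rw [max_eq_right ha.le] at this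
  exact (mul_pos ha ha).ne' this

/-- Some policy has no positive advantage in the environment that responds to its occupancy measure
in the base environment. -/
lemma IsSensitive.exists_advantage_nonpos (hM : M.IsSensitive εr εp) :
    ∃ π : Policy S A, ∀ s a, M.advantage π (M.transitionOf (M.baseOccupancy π))
      (M.rewardOf (M.baseOccupancy π)) s a ≤ 0 := by
  let w : Policy S A → S → A → ℝ := fun π s a =>
    M.advantage π (M.transitionOf (M.baseOccupancy π)) (M.rewardOf (M.baseOccupancy π)) s a
  have hw : ∀ s a, Continuous fun π => w π s a := fun s a =>
    M.continuous_advantage continuous_id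
      (hM.continuous_transitionOf continuous_baseOccupancy isOccupancyMeasure_baseOccupancy)
      (hM.continuous_rewardOf continuous_baseOccupancy isOccupancyMeasure_baseOccupancy) s a
  obtain ⟨π, hπ⟩ := Brouwer.exists_fixedPoint_pi_stdSimplex
    (fun (π : Policy S A) s => improve (π s) (w π s)) <| by
      refine continuous_pi fun s => continuous_induced_rng.2 <| continuous_pi fun a => ?_
      have hm : ∀ b, Continuous fun π : Policy S A => max 0 (w π s b) := fun b =>
        continuous_const.max (hw s b)
      refine ((continuous_policy_apply continuous_id s a).add (hm a)).div
        (continuous_const.add (continuous_finsetSum _ fun b _ => hm b)) fun π => ?_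
      have h : 0 ≤ ∑ b, max 0 (w π s b) := Finset.sum_nonneg fun b _ => le_max_left _ _
      positivity
  exact ⟨π, fun s a => nonpos_of_improve_eq (congrFun hπ s)
    (M.sum_policy_mul_advantage π _ _ s) a⟩

end PerformativeMDP

end

theorem mainTheorem6 {S A : Type*} [Fintype S] [Fintype A] [Nonempty A]
    (M : PerformativeMDP S A) (εr εp : ℝ) (hM : M.IsSensitive εr εp) :
    ∃ d : S × A → ℝ, M.IsPerformativelyStable d := by
  classical
  obtain ⟨π, hπ⟩ := hM.exists_advantage_nonpos
  obtain ⟨hr, hP⟩ := hM.environment_eq π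
  refine ⟨M.occupancy π (M.transitionOf (M.baseOccupancy π)), ?_⟩
  unfold PerformativeMDP.IsPerformativelyStable PerformativeMDP.optimalSolutions
  -- The program of the environment answering this measure is exchanged for that answering
  -- `M.baseOccupancy π`, where optimality is known.
  rw [Set.mem_ofPred_eq, hr, hP]
  exact ⟨M.occupancy_mem _ _, M.isMaxOn_occupancy hπ⟩
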